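/- Let $X_1,X_2,\dots$ be independent, identically distributed, positive random variables having a density with respect to Lebesgue measure, and let $d>0$. Put \[ h^{(1)}(x_1,x_2;d)=\frac{|x_1-x_2|}{x_1+x_2}\,\mathbf 1(x_1+x_2>d),\qquad h^{(2)}(x_1,x_2;d)=\mathbf 1(x_1+x_2>d), \] \[ U_n^{(l)}(d)=\frac{2}{n(n-1)}\sum_{1\le i<j\le n}h^{(l)}(X_i,X_j;d)\quad(l=1,2),\qquad \hat g_n(d)=\frac{U_n^{(1)}(d)}{U_n^{(2)}(d)}, \] where $\hat g_n(d)$ is set to $0$ when $U_n^{(2)}(d)=0$. Let $\nu_d=P(X_1+X_2>d)$ and \[ g(d)=E\Big[\tfrac{|X_1-X_2|}{X_1+X_2}\,\Big|\,X_1+X_2>d\Big]. \] For $l=1,2$ let $\theta_d^{(l)}=E[h^{(l)}(X_1,X_2;d)]$, $\psi_1^{(l)}(x;d)=E[h^{(l)}(x,X_2;d)-\theta_d^{(l)}]$, $\eta_1^{(l)}(d)=E[(\psi_1^{(l)}(X_1;d))^2]$, and let $\eta_1^{(1,2)}(d)=E[\psi_1^{(1)}(X_1;d)\,\psi_1^{(2)}(X_1;d)]$.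 If $\nu_d>0$ and $\eta_1^{(l)}(d)>0$ for $l=1,2$, then, as $n\to\infty$, \[ \sqrt{n\nu_d}\,\big(\hat g_n(d)-g(d)\big)\ \xrightarrow{\ \mathcal D\ }\ N(0,\sigma_d^2),\qquad \sigma_d^2=\frac{4}{\nu_d}\Big(\eta_1^{(1)}(d)-2g(d)\,\eta_1^{(1,2)}(d)+g(d)^2\,\eta_1^{(2)}(d)\Big), \] where $\sigma_d^2\ge 0$ and $N(0,0)$ denotes the point mass at $0$. -/

import Mathlib

open MeasureTheory ProbabilityTheory Filter

namespace GammaTail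

noncomputable section

/-- The kernel `h⁽¹⁾(x, y; d) = |x - y| / (x + y) · 1(x + y > d)`. -/
def h1 (d x y : ℝ) : ℝ := if d < x + y then |x - y| / (x + y) else 0

/-- The kernel `h⁽²⁾(x, y; d) = 1(x + y > d)`. -/
def h2 (d x y : ℝ) : ℝ := if d < x + y then 1 else 0

/-- The U-statistic of degree 2 with kernel `h`, computed from the first `n` observations
(the sample is indexed from `0`, so the sum runs over all pairs `i < j < n`). -/
def uStat {Ω : Type*} (h : ℝ → ℝ → ℝ) (X : ℕ → Ω → ℝ) (n : ℕ) (ω : Ω) : ℝ :=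
  2 / ((n : ℝ) * ((n : ℝ) - 1)) *
    ∑ j ∈ Finset.range n, ∑ i ∈ Finset.range j, h (X i ω) (X j ω)

/-- The ratio estimator `ĝ_n(d) = U_n⁽¹⁾(d) / U_n⁽²⁾(d)`. -/
def gHat {Ω : Type*} (X : ℕ → Ω → ℝ) (d : ℝ) (n : ℕ) (ω : Ω) : ℝ :=
  uStat (h1 d) X n ω / uStat (h2 d) X n ω

variable {Ω : Type*} [MeasurableSpace Ω]

/-- `ν_d = P(X₁ + X₂ > d)`. -/
def nu (P : Measure Ω) (X : ℕ → Ω → ℝ) (d : ℝ) : ℝ :=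
  P.real {ω | d < X 0 ω + X 1 ω}

/-- `g(d) = E[|X₁ - X₂| / (X₁ + X₂) | X₁ + X₂ > d]`, the expectation under the conditional
probability given the event `X₁ + X₂ > d`. -/
def g (P : Measure Ω) (X : ℕ → Ω → ℝ) (d : ℝ) : ℝ :=
  ∫ ω, |X 0 ω - X 1 ω| / (X 0 ω + X 1 ω) ∂(P[|{ω | d < X 0 ω + X 1 ω}])

/-- `θ = E[h(X₁, X₂)]`. -/
def theta (P : Measure Ω) (X : ℕ → Ω → ℝ) (h : ℝ → ℝ → ℝ) : ℝ :=
  ∫ ω, h (X 0 ω) (X 1 ω) ∂P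

/-- The projection `ψ₁(x) = E[h(x, X₂) - θ]` of the centred kernel. -/
def psi (P : Measure Ω) (X : ℕ → Ω → ℝ) (h : ℝ → ℝ → ℝ) (x : ℝ) : ℝ :=
  ∫ ω, (h x (X 1 ω) - theta P X h) ∂P

/-- `E[ψ₁(X₁) ψ₁'(X₁)]` for the projections `ψ₁`, `ψ₁'` of the kernels `h`, `h'`. -/
def eta (P : Measure Ω) (X : ℕ → Ω → ℝ) (h h' : ℝ → ℝ → ℝ) : ℝ :=
  ∫ ω, psi P X h (X 0 ω) * psi P X h' (X 0 ω) ∂P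

/-- The asymptotic variance
`σ_d² = (4 / ν_d) (η₁⁽¹⁾(d) - 2 g(d) η₁⁽¹'²⁾(d) + g(d)² η₁⁽²⁾(d))`. -/
def sigmaSq (P : Measure Ω) (X : ℕ → Ω → ℝ) (d : ℝ) : ℝ :=
  4 / nu P X d * (eta P X (h1 d) (h1 d) - 2 * g P X d * eta P X (h1 d) (h2 d)
    + g P X d ^ 2 * eta P X (h2 d) (h2 d))

end

end GammaTail

/-! Neither a joint central limit theorem nor the delta method is needed. The kernel `κ = h1 - g *
h2` has mean zero because `g * nu` is the mean of `h1` (`g_mul_nu`), and wherever the denominator is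
nonzero the estimation error is exactly `U_n(κ) / U_n(h2)`. A scalar CLT for `√n * U_n(κ)`, the weak
law `U_n(h2) → nu` and Slutsky's theorem (`tendstoInDistribution_div`) give the limit; bilinearity
of `eta` (`eta_sub_mul`) turns `4 * eta κ κ / nu` into `sigmaSq`, which also shows it is
nonnegative.

The CLT for a bounded symmetric kernel rests on Hoeffding's decomposition (`uStat_sub_theta_eq`): an
i.i.d. average of projections, covered by the classical CLT, plus a U-statistic with a degenerate
kernel. The summands of the latter are pairwise orthogonal (`integral_degenerate_mul_eq_zero`), so
it vanishes in mean square even after scaling by `√n`.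

Off the positive quadrant `h1` is unbounded, so the argument uses `h1Trunc`, which gives almost
surely the same statistics. -/

namespace GammaTail

open scoped Topology

/-! ### Convergence in probability to zero; integrating out an independent variable -/

section Auxiliary

variable {Ω : Type*} [MeasurableSpace Ω] {P : Measure Ω} [IsProbabilityMeasure P]

/-- Chebyshev's inequality. -/
theorem tendstoInMeasure_zero_of_integral_sq {Z : ℕ → Ω → ℝ}
    (h_int : ∀ n, Integrable (fun ω => Z n ω ^ 2) P)
    (hlim : Tendsto (fun n => ∫ ω, Z n ω ^ 2 ∂P) atTop (𝓝 0)) :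
    TendstoInMeasure P Z atTop 0 := by
  rw [tendstoInMeasure_iff_measureReal_norm]
  intro ε hε
  have key : ∀ n, P.real {x | ε ≤ ‖Z n x - (0 : Ω → ℝ) x‖} ≤ (∫ ω, Z n ω ^ 2 ∂P) / ε ^ 2 := by
    intro n
    have h := mul_meas_ge_le_integral_of_nonneg (ae_of_all P fun ω => sq_nonneg (Z n ω))
      (h_int n) (ε ^ 2)
    rw [le_div_iff₀ (by positivity), mul_comm]
    refine le_trans (le_of_eq ?_) h
    congr 2
    ext x
    simp only [Pi.zero_apply, sub_zero, Real.norm_eq_abs, Set.mem_ofPred_eq]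
    rw [← sq_abs (Z n x), pow_le_pow_iff_left₀ hε.le (abs_nonneg _) two_ne_zero]
  refine squeeze_zero (fun n => measureReal_nonneg) key ?_
  simpa using hlim.div_const (ε ^ 2)

theorem tendstoInMeasure_zero_add {Y Z : ℕ → Ω → ℝ} (hY : TendstoInMeasure P Y atTop 0)
    (hZ : TendstoInMeasure P Z atTop 0) : TendstoInMeasure P (Y + Z) atTop 0 := by
  rw [tendstoInMeasure_iff_measureReal_norm] at *
  intro ε hε
  have h := (hY (ε / 2) (by positivity)).add (hZ (ε / 2) (by positivity))
  rw [zero_add] at h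
  refine squeeze_zero (fun n => measureReal_nonneg) (fun n => ?_) h
  refine (measureReal_mono ?_).trans (measureReal_union_le _ _)
  intro x hx
  simp only [Set.mem_ofPred_eq, Pi.zero_apply, sub_zero, Pi.add_apply, Set.mem_union] at *
  by_contra! hc
  linarith [norm_add_le (Y n x) (Z n x)]

/-- Disposes of identities that fail only on events of vanishing probability, such as a denominator
being zero. -/
theorem tendstoInMeasure_zero_of_eq_zero_off {Y : ℕ → Ω → ℝ} {A : ℕ → Set Ω}
    (hY : ∀ n, ∀ ω ∉ A n, Y n ω = 0) (hA : Tendsto (fun n => P.real (A n)) atTop (𝓝 0)) :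
    TendstoInMeasure P Y atTop 0 := by
  rw [tendstoInMeasure_iff_measureReal_norm]
  intro ε hε
  refine squeeze_zero (fun n => measureReal_nonneg) (fun n => measureReal_mono fun x hx => ?_) hA
  by_contra hc
  simp only [Set.mem_ofPred_eq, hY n x hc, Pi.zero_apply, sub_zero, norm_zero] at hx
  linarith

/-- By independence and Fubini, `Y` can be integrated out first with `W` frozen. -/
theorem integral_eq_zero_of_indepFun {β : Type*} [MeasurableSpace β] {W : Ω → β} {Y : Ω → ℝ}
    (hWY : IndepFun W Y P) (hW : AEMeasurable W P) (hY : AEMeasurable Y P) {F : β → ℝ → ℝ}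
    (hF : Measurable (Function.uncurry F)) {C : ℝ} (hC : ∀ w y, |F w y| ≤ C)
    (hzero : ∀ w, ∫ y, F w y ∂(P.map Y) = 0) : ∫ ω, F (W ω) (Y ω) ∂P = 0 := by
  have := Measure.isProbabilityMeasure_map hW
  have := Measure.isProbabilityMeasure_map hY
  have h : ∫ ω, F (W ω) (Y ω) ∂P
      = ∫ z, Function.uncurry F z ∂(P.map fun ω => (W ω, Y ω)) := by
    rw [integral_map (hW.prodMk hY) hF.aestronglyMeasurable]
    rfl
  rw [h, hWY.map_prod_eq_prod_map_map hW hY, integral_prod]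
  · simp [hzero]
  · exact Integrable.of_bound hF.aestronglyMeasurable C (ae_of_all _ fun z => hC z.1 z.2)

end Auxiliary

/-! ### Sums over pairs of indices -/

section SumIdentities

theorem sum_pairs_add (a : ℕ → ℝ) (n : ℕ) :
    ∑ j ∈ Finset.range n, ∑ i ∈ Finset.range j, (a i + a j)
      = ((n : ℝ) - 1) * ∑ i ∈ Finset.range n, a i := by
  induction n with
  | zero => simp
  | succ n ih =>
    rw [Finset.sum_range_succ, ih, Finset.sum_range_succ, Finset.sum_add_distrib]
    simp only [Finset.sum_const, Finset.card_range, nsmul_eq_mul]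
    push_cast
    ring

theorem sum_pairs_const (c : ℝ) (n : ℕ) :
    ∑ j ∈ Finset.range n, ∑ _i ∈ Finset.range j, c = (n : ℝ) * ((n : ℝ) - 1) / 2 * c := by
  induction n with
  | zero => simp
  | succ n ih =>
    rw [Finset.sum_range_succ, ih]
    simp only [Finset.sum_const, Finset.card_range, nsmul_eq_mul]
    push_cast
    ring

end SumIdentities

/-! ### Hoeffding decomposition -/

section HoeffdingDecomposition

variable {Ω : Type*} [MeasurableSpace Ω] {P : Measure Ω}
  {X : ℕ → Ω → ℝ} {k : ℝ → ℝ → ℝ}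

/-- The degenerate part of the kernel `k` in its Hoeffding decomposition. -/
noncomputable def degenerate (P : Measure Ω) (X : ℕ → Ω → ℝ) (k : ℝ → ℝ → ℝ) (x y : ℝ) : ℝ :=
  k x y - theta P X k - psi P X k x - psi P X k y

theorem aemeasurable_of_identDistrib (hident : ∀ i, IdentDistrib (X i) (X 0) P P) (i : ℕ) :
    AEMeasurable (X i) P :=
  (hident i).aemeasurable_fst

theorem degenerate_symm (hsymm : ∀ x y, k x y = k y x) (x y : ℝ) :
    degenerate P X k x y = degenerate P X k y x := by
  unfold degenerate
  rw [hsymm x y]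
  ring

/-- Each index lies in `n - 1` pairs, which turns the normalisation `2 / (n (n - 1))` into `2 / n`
on the projections. -/
theorem uStat_sub_theta_eq (X : ℕ → Ω → ℝ) (k : ℝ → ℝ → ℝ) {n : ℕ} (hn : 2 ≤ n) (ω : Ω) :
    uStat k X n ω - theta P X k
      = 2 / (n : ℝ) * ∑ i ∈ Finset.range n, psi P X k (X i ω)
        + uStat (degenerate P X k) X n ω := by
  have hn' : (2 : ℝ) ≤ n := by exact_mod_cast hn
  have h0 : (n : ℝ) ≠ 0 := by linarith
  have h1 : (n : ℝ) - 1 ≠ 0 := by linarith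
  have hdec : ∑ j ∈ Finset.range n, ∑ i ∈ Finset.range j, degenerate P X k (X i ω) (X j ω)
      = ∑ j ∈ Finset.range n, ∑ i ∈ Finset.range j, k (X i ω) (X j ω)
        - (n : ℝ) * ((n : ℝ) - 1) / 2 * theta P X k
        - ((n : ℝ) - 1) * ∑ i ∈ Finset.range n, psi P X k (X i ω) := by
    rw [← sum_pairs_const, ← sum_pairs_add]
    simp only [← Finset.sum_sub_distrib]
    refine Finset.sum_congr rfl fun j _ => Finset.sum_congr rfl fun i _ => ?_
    unfold degenerate
    ring
  unfold uStat
  rw [hdec]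
  field_simp
  ring

theorem aemeasurable_uStat (hX : ∀ i, AEMeasurable (X i) P)
    (hk : Measurable (Function.uncurry k)) (n : ℕ) : AEMeasurable (uStat k X n) P :=
  (Finset.aemeasurable_fun_sum _ fun j _ => Finset.aemeasurable_fun_sum _ fun i _ =>
    hk.comp_aemeasurable ((hX i).prodMk (hX j))).const_mul _

/-- Frees the projection from the particular variable `X 1` in its definition, so that any `X i` may
be integrated out. -/
theorem psi_eq_integral_map (hident : ∀ i, IdentDistrib (X i) (X 0) P P)
    (hk : Measurable (Function.uncurry k)) (i : ℕ) (x : ℝ) :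
    psi P X k x = ∫ y, (k x y - theta P X k) ∂(P.map (X i)) := by
  have hm : Measurable fun y => k x y - theta P X k :=
    (hk.comp measurable_prodMk_left).sub_const _
  rw [(hident i).map_eq, ← (hident 1).map_eq,
    integral_map (aemeasurable_of_identDistrib hident 1) hm.aestronglyMeasurable]
  rfl

end HoeffdingDecomposition

/-! ### Negligibility of the degenerate part, CLT and weak law for U-statistics -/

section UStatistic

variable {Ω : Type*} [MeasurableSpace Ω] {P : Measure Ω} [IsProbabilityMeasure P]
  {X : ℕ → Ω → ℝ} {k : ℝ → ℝ → ℝ} {C : ℝ}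

theorem measurable_psi (hident : ∀ i, IdentDistrib (X i) (X 0) P P)
    (hk : Measurable (Function.uncurry k)) : Measurable (psi P X k) := by
  have := Measure.isProbabilityMeasure_map (aemeasurable_of_identDistrib hident 0)
  have hm : StronglyMeasurable (Function.uncurry fun x y => k x y - theta P X k) :=
    (hk.sub_const (theta P X k)).stronglyMeasurable
  have h := hm.integral_prod_right (ν := P.map (X 0))
  rw [funext (psi_eq_integral_map hident hk 0)]
  exact h.measurable

theorem abs_theta_le (hC : ∀ x y, |k x y| ≤ C) : |theta P X k| ≤ C := by
  have h := norm_integral_le_of_norm_le_const (μ := P)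
    (f := fun ω => k (X 0 ω) (X 1 ω)) (ae_of_all P fun ω => hC _ _)
  simpa [theta] using h

theorem abs_psi_le (hC : ∀ x y, |k x y| ≤ C) (x : ℝ) : |psi P X k x| ≤ 2 * C := by
  have h := norm_integral_le_of_norm_le_const (μ := P) (C := 2 * C)
    (f := fun ω => k x (X 1 ω) - theta P X k) (ae_of_all P fun ω => by
      rw [Real.norm_eq_abs]
      linarith [abs_sub (k x (X 1 ω)) (theta P X k), hC x (X 1 ω),
        abs_theta_le (P := P) (X := X) hC])
  simpa [psi] using h

theorem integral_psi_map (hindep : iIndepFun X P)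
    (hident : ∀ i, IdentDistrib (X i) (X 0) P P) (hk : Measurable (Function.uncurry k))
    (hC : ∀ x y, |k x y| ≤ C) (i : ℕ) : ∫ x, psi P X k x ∂(P.map (X i)) = 0 := by
  have hX := aemeasurable_of_identDistrib hident
  have := Measure.isProbabilityMeasure_map (hX 0)
  have := Measure.isProbabilityMeasure_map (hX 1)
  have h_int : Integrable (Function.uncurry k) ((P.map (X 0)).prod (P.map (X 1))) :=
    Integrable.of_bound hk.aestronglyMeasurable C (ae_of_all _ fun z => hC z.1 z.2)
  have htheta : theta P X k
      = ∫ z, Function.uncurry k z ∂((P.map (X 0)).prod (P.map (X 1))) := by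
    rw [← (hindep.indepFun zero_ne_one).map_prod_eq_prod_map_map (hX 0) (hX 1),
      integral_map ((hX 0).prodMk (hX 1)) hk.aestronglyMeasurable]
    rfl
  rw [(hident i).map_eq]
  simp_rw [psi_eq_integral_map hident hk 1]
  have h := integral_prod _ (h_int.sub (integrable_const (theta P X k)))
  simp only [Pi.sub_apply, Function.uncurry_apply_pair] at h
  rw [← h, integral_sub h_int (integrable_const _), ← htheta]
  simp

theorem integral_psi (hindep : iIndepFun X P)
    (hident : ∀ i, IdentDistrib (X i) (X 0) P P) (hk : Measurable (Function.uncurry k))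
    (hC : ∀ x y, |k x y| ≤ C) (i : ℕ) : ∫ ω, psi P X k (X i ω) ∂P = 0 := by
  rw [← integral_psi_map hindep hident hk hC i, integral_map
    (aemeasurable_of_identDistrib hident i) (measurable_psi hident hk).aestronglyMeasurable]

theorem measurable_degenerate (hident : ∀ i, IdentDistrib (X i) (X 0) P P)
    (hk : Measurable (Function.uncurry k)) :
    Measurable (Function.uncurry (degenerate P X k)) := by
  have h := measurable_psi hident hk
  exact ((hk.sub_const _).sub (h.comp measurable_fst)).sub (h.comp measurable_snd)

theorem abs_degenerate_le (hC : ∀ x y, |k x y| ≤ C) (x y : ℝ) :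
    |degenerate P X k x y| ≤ 6 * C := by
  have h1 := abs_le.1 (hC x y)
  have h2 := abs_le.1 (abs_theta_le (P := P) (X := X) hC)
  have h3 := abs_le.1 (abs_psi_le (P := P) (X := X) hC x)
  have h4 := abs_le.1 (abs_psi_le (P := P) (X := X) hC y)
  rw [degenerate, abs_le]
  constructor <;> linarith

/-- Integrating out `y` turns `k x y - theta` into the projection at `x`, which cancels, while the
projection at `y` has mean zero. -/
theorem integral_degenerate_map (hindep : iIndepFun X P)
    (hident : ∀ i, IdentDistrib (X i) (X 0) P P) (hk : Measurable (Function.uncurry k))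
    (hC : ∀ x y, |k x y| ≤ C) (i : ℕ) (x : ℝ) :
    ∫ y, degenerate P X k x y ∂(P.map (X i)) = 0 := by
  have := Measure.isProbabilityMeasure_map (aemeasurable_of_identDistrib hident i)
  have hk' : Integrable (fun y => k x y - theta P X k) (P.map (X i)) :=
    (Integrable.of_bound (hk.comp measurable_prodMk_left).aestronglyMeasurable C
      (ae_of_all _ fun y => hC x y)).sub (integrable_const _)
  have hp : Integrable (psi P X k) (P.map (X i)) :=
    Integrable.of_bound (measurable_psi hident hk).aestronglyMeasurable (2 * C)
      (ae_of_all _ fun y => abs_psi_le hC y)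
  have hsub : Integrable (fun y => k x y - theta P X k - psi P X k x) (P.map (X i)) :=
    hk'.sub (integrable_const _)
  unfold degenerate
  rw [integral_sub hsub hp, integral_sub hk' (integrable_const _),
    ← psi_eq_integral_map hident hk i, integral_psi_map hindep hident hk hC]
  simp

/-- `X a` enters only one factor and is independent of the block indexed by `{b, c, e}`, so
integrating it out gives zero. A finset of indices is used because `b`, `c`, `e` may coincide. -/
theorem integral_degenerate_mul_of_notMem (hindep : iIndepFun X P)
    (hident : ∀ i, IdentDistrib (X i) (X 0) P P) (hk : Measurable (Function.uncurry k))
    (hC : ∀ x y, |k x y| ≤ C) {a b c e : ℕ} (ha : a ∉ ({b, c, e} : Finset ℕ)) :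
    ∫ ω, degenerate P X k (X b ω) (X a ω) * degenerate P X k (X c ω) (X e ω) ∂P = 0 := by
  have hX := aemeasurable_of_identDistrib hident
  set S : Finset ℕ := {b, c, e} with hS
  let b' : S := ⟨b, by simp [hS]⟩
  let c' : S := ⟨c, by simp [hS]⟩
  let e' : S := ⟨e, by simp [hS]⟩
  have hind : IndepFun (fun ω (i : S) => X i ω) (X a) P :=
    (hindep.indepFun_finset₀ S {a} (by simpa using ha) hX).comp measurable_id
      (measurable_pi_apply (⟨a, by simp⟩ : ({a} : Finset ℕ)))
  have hD := measurable_degenerate hident hk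
  refine integral_eq_zero_of_indepFun (W := fun ω (i : S) => X i ω) (Y := X a)
    (F := fun w y => degenerate P X k (w b') y * degenerate P X k (w c') (w e'))
    hind (aemeasurable_pi_lambda _ fun i => hX i) (hX a) ?_ (C := 6 * C * (6 * C)) ?_ ?_
  · have hpr (s : S) : Measurable fun p : (S → ℝ) × ℝ => p.1 s :=
      (measurable_pi_apply s).comp measurable_fst
    exact (hD.comp ((hpr b').prodMk measurable_snd)).mul (hD.comp ((hpr c').prodMk (hpr e')))
  · intro w y
    rw [abs_mul]
    have h := abs_degenerate_le (P := P) (X := X) hC (w b') y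
    exact mul_le_mul h (abs_degenerate_le hC _ _) (abs_nonneg _) ((abs_nonneg _).trans h)
  · intro w
    rw [integral_mul_const, integral_degenerate_map hindep hident hk hC, zero_mul]

theorem integral_degenerate_mul_eq_zero (hindep : iIndepFun X P)
    (hident : ∀ i, IdentDistrib (X i) (X 0) P P) (hk : Measurable (Function.uncurry k))
    (hC : ∀ x y, |k x y| ≤ C) (hsymm : ∀ x y, k x y = k y x) {i j l m : ℕ} (hij : i < j)
    (hlm : l < m) (hne : ¬ (i = l ∧ j = m)) :
    ∫ ω, degenerate P X k (X i ω) (X j ω) * degenerate P X k (X l ω) (X m ω) ∂P = 0 := by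
  -- An index occurring only once: the larger of the two maxima, or, if these agree, the minimum
  -- `i`, which then differs from `l`.
  rcases lt_trichotomy j m with h | h | h
  · rw [← integral_degenerate_mul_of_notMem hindep hident hk hC (a := m) (b := l) (c := i)
      (e := j) (by simp; omega)]
    simp_rw [mul_comm]
  · rw [← integral_degenerate_mul_of_notMem hindep hident hk hC (a := i) (b := j) (c := l)
      (e := m) (by simp; omega)]
    simp_rw [degenerate_symm hsymm (X i _) (X j _)]
  · exact integral_degenerate_mul_of_notMem hindep hident hk hC (by simp; omega)

theorem integrable_degenerate_mul (hident : ∀ i, IdentDistrib (X i) (X 0) P P)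
    (hk : Measurable (Function.uncurry k)) (hC : ∀ x y, |k x y| ≤ C) (i j l m : ℕ) :
    Integrable (fun ω => degenerate P X k (X i ω) (X j ω) * degenerate P X k (X l ω) (X m ω))
      P := by
  have hX := aemeasurable_of_identDistrib hident
  have hD := measurable_degenerate hident hk
  refine Integrable.of_bound ((hD.comp_aemeasurable ((hX i).prodMk (hX j))).mul
    (hD.comp_aemeasurable ((hX l).prodMk (hX m)))).aestronglyMeasurable (6 * C * (6 * C))
    (ae_of_all _ fun ω => ?_)
  have h := abs_degenerate_le (P := P) (X := X) hC (X i ω) (X j ω)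
  rw [norm_mul]
  exact mul_le_mul h (abs_degenerate_le hC _ _) (abs_nonneg _) ((abs_nonneg _).trans h)

theorem sq_sum_pairs (f : ℕ → ℕ → ℝ) (n : ℕ) :
    (∑ j ∈ Finset.range n, ∑ i ∈ Finset.range j, f i j) ^ 2
      = ∑ p ∈ (Finset.range n).sigma fun j => Finset.range j,
        ∑ q ∈ (Finset.range n).sigma fun j => Finset.range j, f p.2 p.1 * f q.2 q.1 := by
  rw [Finset.sum_sigma', sq, Finset.sum_mul_sum]

theorem integrable_sq_sum_degenerate (hident : ∀ i, IdentDistrib (X i) (X 0) P P)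
    (hk : Measurable (Function.uncurry k)) (hC : ∀ x y, |k x y| ≤ C) (n : ℕ) :
    Integrable (fun ω => (∑ j ∈ Finset.range n, ∑ i ∈ Finset.range j,
      degenerate P X k (X i ω) (X j ω)) ^ 2) P := by
  simp_rw [sq_sum_pairs (fun i j => degenerate P X k (X i _) (X j _))]
  exact integrable_finsetSum _ fun p _ => integrable_finsetSum _ fun q _ =>
    integrable_degenerate_mul hident hk hC _ _ _ _

/-- By orthogonality only the `n (n - 1) / 2` diagonal terms survive, each at most `(6 * C) ^ 2`. -/
theorem integral_sq_sum_degenerate_le (hindep : iIndepFun X P)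
    (hident : ∀ i, IdentDistrib (X i) (X 0) P P) (hk : Measurable (Function.uncurry k))
    (hC : ∀ x y, |k x y| ≤ C) (hsymm : ∀ x y, k x y = k y x) (n : ℕ) :
    ∫ ω, (∑ j ∈ Finset.range n, ∑ i ∈ Finset.range j,
      degenerate P X k (X i ω) (X j ω)) ^ 2 ∂P ≤ (n : ℝ) * ((n : ℝ) - 1) / 2 * (6 * C) ^ 2 := by
  simp_rw [sq_sum_pairs (fun i j => degenerate P X k (X i _) (X j _))]
  rw [integral_finsetSum _ fun p _ => integrable_finsetSum _ fun q _ =>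
    integrable_degenerate_mul hident hk hC _ _ _ _]
  rw [← sum_pairs_const, Finset.sum_sigma']
  refine Finset.sum_le_sum fun p hp => ?_
  rw [integral_finsetSum _ fun q _ => integrable_degenerate_mul hident hk hC _ _ _ _,
    Finset.sum_eq_single_of_mem p hp]
  · have h := norm_integral_le_of_norm_le_const (μ := P) (C := (6 * C) ^ 2)
      (f := fun ω => degenerate P X k (X p.2 ω) (X p.1 ω) * degenerate P X k (X p.2 ω) (X p.1 ω))
      (ae_of_all P fun ω => by
        rw [← sq, norm_pow]
        exact pow_le_pow_left₀ (norm_nonneg _) (abs_degenerate_le hC _ _) 2)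
    rw [probReal_univ, mul_one] at h
    exact (le_abs_self _).trans h
  · intro q hq hqp
    simp only [Finset.mem_sigma, Finset.mem_range] at hp hq
    refine integral_degenerate_mul_eq_zero hindep hident hk hC hsymm hp.2 hq.2 fun h => hqp ?_
    exact Sigma.ext h.2.symm (heq_of_eq h.1.symm)

theorem tendstoInMeasure_sqrt_mul_uStat_degenerate (hindep : iIndepFun X P)
    (hident : ∀ i, IdentDistrib (X i) (X 0) P P) (hk : Measurable (Function.uncurry k))
    (hC : ∀ x y, |k x y| ≤ C) (hsymm : ∀ x y, k x y = k y x) :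
    TendstoInMeasure P (fun (n : ℕ) ω => √(n : ℝ) * uStat (degenerate P X k) X n ω) atTop 0 := by
  have hsq : ∀ (n : ℕ) ω, (√(n : ℝ) * uStat (degenerate P X k) X n ω) ^ 2
      = n * (2 / ((n : ℝ) * ((n : ℝ) - 1))) ^ 2 * (∑ j ∈ Finset.range n, ∑ i ∈ Finset.range j,
        degenerate P X k (X i ω) (X j ω)) ^ 2 := fun n ω => by
    rw [uStat, mul_pow, mul_pow, Real.sq_sqrt (Nat.cast_nonneg n), mul_assoc]
  refine tendstoInMeasure_zero_of_integral_sq (fun n => ?_) ?_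
  · simp_rw [hsq]
    exact (integrable_sq_sum_degenerate hident hk hC n).const_mul _
  -- This bound is `n * (2 / (n (n - 1))) ^ 2` times the second-moment bound `n (n - 1) / 2 * (6 *
  -- C) ^ 2`.
  · have hlim : Tendsto (fun n : ℕ => 2 * (6 * C) ^ 2 / ((n : ℝ) - 1)) atTop (𝓝 0) :=
      (tendsto_atTop_add_const_right _ (-1) tendsto_natCast_atTop_atTop).const_div_atTop _
    refine squeeze_zero' (.of_forall fun n => integral_nonneg fun ω => sq_nonneg _) ?_ hlim
    filter_upwards [eventually_ge_atTop 2] with n hn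
    have hn' : (2 : ℝ) ≤ n := by exact_mod_cast hn
    have h0 : (n : ℝ) ≠ 0 := by linarith
    have h1 : (n : ℝ) - 1 ≠ 0 := by linarith
    simp_rw [hsq]
    rw [integral_const_mul]
    refine (mul_le_mul_of_nonneg_left
      (integral_sq_sum_degenerate_le hindep hident hk hC hsymm n) (by positivity)).trans ?_
    apply le_of_eq
    field_simp

theorem iIndepFun_psi (hindep : iIndepFun X P) (hident : ∀ i, IdentDistrib (X i) (X 0) P P)
    (hk : Measurable (Function.uncurry k)) :
    iIndepFun (fun i ω => psi P X k (X i ω)) P :=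
  hindep.comp (fun _ => psi P X k) fun _ => measurable_psi hident hk

theorem identDistrib_psi (hident : ∀ i, IdentDistrib (X i) (X 0) P P)
    (hk : Measurable (Function.uncurry k)) (i : ℕ) :
    IdentDistrib (fun ω => psi P X k (X i ω)) (fun ω => psi P X k (X 0 ω)) P P :=
  (hident i).comp (measurable_psi hident hk)

theorem memLp_psi (hident : ∀ i, IdentDistrib (X i) (X 0) P P)
    (hk : Measurable (Function.uncurry k)) (hC : ∀ x y, |k x y| ≤ C) (p : ENNReal) (i : ℕ) :
    MemLp (fun ω => psi P X k (X i ω)) p P :=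
  MemLp.of_bound (identDistrib_psi hident hk i).aemeasurable_fst.aestronglyMeasurable (2 * C)
    (ae_of_all _ fun _ => abs_psi_le hC _)

/-- The central limit theorem for U-statistics of degree 2 with a bounded symmetric kernel. -/
theorem tendstoInDistribution_uStat (hindep : iIndepFun X P)
    (hident : ∀ i, IdentDistrib (X i) (X 0) P P) (hk : Measurable (Function.uncurry k))
    (hC : ∀ x y, |k x y| ≤ C) (hsymm : ∀ x y, k x y = k y x) :
    TendstoInDistribution
      (fun (n : ℕ) (ω : Ω) => √(n : ℝ) * (uStat k X n ω - theta P X k)) atTop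
      (fun x : ℝ => 2 * x) (fun _ => P) (gaussianReal 0 (eta P X k k).toNNReal) := by
  have hvar : Var[fun ω => psi P X k (X 0 ω); P] = eta P X k k := by
    rw [variance_of_integral_eq_zero (identDistrib_psi hident hk 0).aemeasurable_fst
      (integral_psi hindep hident hk hC 0)]
    simp only [eta, sq]
  have hclt := tendstoInDistribution_inv_sqrt_mul_sum_sub (P := P)
    (X := fun i ω => psi P X k (X i ω)) (Y := id) (P' := gaussianReal 0 (eta P X k k).toNNReal)
    (by rw [hvar]; exact HasLaw.id) (memLp_psi hident hk hC 2 0)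
    (iIndepFun_psi hindep hident hk) (identDistrib_psi hident hk)
  have hclt2 := hclt.continuous_comp (g := fun x : ℝ => 2 * x) (by fun_prop)
  -- The difference from twice the normalised sum of projections is exactly `√n` times the
  -- degenerate U-statistic.
  refine tendstoInDistribution_of_tendstoInMeasure_sub _ _ hclt2 ?_ fun n =>
    ((aemeasurable_uStat (aemeasurable_of_identDistrib hident) hk n).sub_const _).const_mul _
  refine (tendstoInMeasure_sqrt_mul_uStat_degenerate hindep hident hk hC hsymm).congr' ?_ .rfl
  filter_upwards [eventually_ge_atTop 2] with n hn
  refine ae_of_all _ fun ω => ?_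
  have hn' : (2 : ℝ) ≤ n := by exact_mod_cast hn
  have hs : √(n : ℝ) ≠ 0 := (Real.sqrt_pos.2 (by linarith)).ne'
  have hs2 : √(n : ℝ) ^ 2 = n := Real.sq_sqrt (Nat.cast_nonneg n)
  simp only [Pi.sub_apply, Function.comp_apply, integral_psi hindep hident hk hC 0,
    uStat_sub_theta_eq (P := P) X k hn, mul_zero, sub_zero]
  nth_rewrite 3 [← hs2]
  field_simp
  ring

/-- The strong law handles the projections; the degenerate part is negligible even after
multiplication by `√n ≥ 1`. -/
theorem tendstoInMeasure_uStat (hindep : iIndepFun X P)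
    (hident : ∀ i, IdentDistrib (X i) (X 0) P P) (hk : Measurable (Function.uncurry k))
    (hC : ∀ x y, |k x y| ≤ C) (hsymm : ∀ x y, k x y = k y x) :
    TendstoInMeasure P (fun (n : ℕ) ω => uStat k X n ω - theta P X k) atTop 0 := by
  have hlaw : TendstoInMeasure P
      (fun (n : ℕ) ω => 2 / (n : ℝ) * ∑ i ∈ Finset.range n, psi P X k (X i ω)) atTop 0 := by
    refine tendstoInMeasure_of_tendsto_ae (fun n => (AEMeasurable.const_mul
      (Finset.aemeasurable_fun_sum _ fun i _ =>
        (identDistrib_psi hident hk i).aemeasurable_fst) _).aestronglyMeasurable) ?_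
    filter_upwards [strong_law_ae_real (fun i ω => psi P X k (X i ω))
      ((memLp_psi hident hk hC 1 0).integrable le_rfl)
      (fun i j hij => (iIndepFun_psi hindep hident hk).indepFun hij)
      (identDistrib_psi hident hk)] with ω hω
    rw [integral_psi hindep hident hk hC 0] at hω
    have := hω.const_mul 2
    rw [mul_zero] at this
    refine this.congr fun n => ?_
    ring
  have hdeg : TendstoInMeasure P (fun (n : ℕ) ω => uStat (degenerate P X k) X n ω) atTop 0 := by
    have h := tendstoInMeasure_sqrt_mul_uStat_degenerate hindep hident hk hC hsymm
    rw [tendstoInMeasure_iff_measureReal_norm] at h ⊢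
    intro ε hε
    refine squeeze_zero' (.of_forall fun n => measureReal_nonneg) ?_ (h ε hε)
    filter_upwards [eventually_ge_atTop 1] with n hn
    refine measureReal_mono fun ω hω => ?_
    have hn' : (1 : ℝ) ≤ √(n : ℝ) := Real.one_le_sqrt.2 (by exact_mod_cast hn)
    simp only [Set.mem_ofPred_eq, Pi.zero_apply, sub_zero, norm_mul] at hω ⊢
    rw [Real.norm_of_nonneg (Real.sqrt_nonneg _)]
    nlinarith [norm_nonneg (uStat (degenerate P X k) X n ω)]
  refine (tendstoInMeasure_zero_add hlaw hdeg).congr' ?_ .rfl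
  filter_upwards [eventually_ge_atTop 2] with n hn
  exact ae_of_all _ fun ω => (uStat_sub_theta_eq X k hn ω).symm

end UStatistic

/-! ### Linearity in the kernel -/

section Linearity

theorem uStat_sub_mul {Ω : Type*} (X : ℕ → Ω → ℝ) (k l : ℝ → ℝ → ℝ) (c : ℝ) (n : ℕ) (ω : Ω) :
    uStat (fun x y => k x y - c * l x y) X n ω = uStat k X n ω - c * uStat l X n ω := by
  unfold uStat
  simp only [Finset.sum_sub_distrib, ← Finset.mul_sum]
  ring

variable {Ω : Type*} [MeasurableSpace Ω] {P : Measure Ω} [IsProbabilityMeasure P]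
  {X : ℕ → Ω → ℝ} {k l : ℝ → ℝ → ℝ} {C D : ℝ}

theorem theta_sub_mul (hX : ∀ i, AEMeasurable (X i) P) (hk : Measurable (Function.uncurry k))
    (hl : Measurable (Function.uncurry l)) (hC : ∀ x y, |k x y| ≤ C) (hD : ∀ x y, |l x y| ≤ D)
    (c : ℝ) :
    theta P X (fun x y => k x y - c * l x y) = theta P X k - c * theta P X l := by
  have h1 : Integrable (fun ω => k (X 0 ω) (X 1 ω)) P :=
    Integrable.of_bound (hk.comp_aemeasurable ((hX 0).prodMk (hX 1))).aestronglyMeasurable C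
      (ae_of_all _ fun _ => hC _ _)
  have h2 : Integrable (fun ω => l (X 0 ω) (X 1 ω)) P :=
    Integrable.of_bound (hl.comp_aemeasurable ((hX 0).prodMk (hX 1))).aestronglyMeasurable D
      (ae_of_all _ fun _ => hD _ _)
  unfold theta
  rw [integral_sub h1 (h2.const_mul c), integral_const_mul]

theorem psi_sub_mul (hX : ∀ i, AEMeasurable (X i) P) (hk : Measurable (Function.uncurry k))
    (hl : Measurable (Function.uncurry l)) (hC : ∀ x y, |k x y| ≤ C) (hD : ∀ x y, |l x y| ≤ D)
    (c x : ℝ) :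
    psi P X (fun x y => k x y - c * l x y) x = psi P X k x - c * psi P X l x := by
  have h1 : Integrable (fun ω => k x (X 1 ω)) P :=
    Integrable.of_bound ((hk.comp measurable_prodMk_left).comp_aemeasurable
      (hX 1)).aestronglyMeasurable C (ae_of_all _ fun _ => hC _ _)
  have h2 : Integrable (fun ω => l x (X 1 ω)) P :=
    Integrable.of_bound ((hl.comp measurable_prodMk_left).comp_aemeasurable
      (hX 1)).aestronglyMeasurable D (ae_of_all _ fun _ => hD _ _)
  have h3 : Integrable (fun ω => k x (X 1 ω) - c * l x (X 1 ω)) P := h1.sub (h2.const_mul c)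
  unfold psi
  rw [theta_sub_mul hX hk hl hC hD, integral_sub h3 (integrable_const _),
    integral_sub h1 (h2.const_mul c), integral_sub h1 (integrable_const _),
    integral_sub h2 (integrable_const _), integral_const_mul]
  simp only [integral_const, probReal_univ, smul_eq_mul, one_mul]
  ring

theorem eta_sub_mul (hident : ∀ i, IdentDistrib (X i) (X 0) P P)
    (hk : Measurable (Function.uncurry k)) (hl : Measurable (Function.uncurry l))
    (hC : ∀ x y, |k x y| ≤ C) (hD : ∀ x y, |l x y| ≤ D) (c : ℝ) :
    eta P X (fun x y => k x y - c * l x y) (fun x y => k x y - c * l x y)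
      = eta P X k k - 2 * c * eta P X k l + c ^ 2 * eta P X l l := by
  have hX := aemeasurable_of_identDistrib hident
  have h_int {p q : ℝ → ℝ → ℝ} {B B' : ℝ} (hp : Measurable (Function.uncurry p))
      (hB : ∀ x y, |p x y| ≤ B) (hq : Measurable (Function.uncurry q))
      (hB' : ∀ x y, |q x y| ≤ B') :
      Integrable (fun ω => psi P X p (X 0 ω) * psi P X q (X 0 ω)) P :=
    (memLp_psi hident hp hB 2 0).integrable_mul (memLp_psi hident hq hB' 2 0)
  have hkl := (h_int hk hC hl hD).const_mul (2 * c)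
  have hll := (h_int hl hD hl hD).const_mul (c ^ 2)
  have hsub : Integrable (fun ω => psi P X k (X 0 ω) * psi P X k (X 0 ω)
      - 2 * c * (psi P X k (X 0 ω) * psi P X l (X 0 ω))) P := (h_int hk hC hk hC).sub hkl
  unfold eta
  rw [← integral_const_mul, ← integral_const_mul, ← integral_sub (h_int hk hC hk hC) hkl,
    ← integral_add hsub hll]
  refine integral_congr_ae (ae_of_all _ fun ω => ?_)
  simp only [psi_sub_mul hX hk hl hC hD]
  ring

end Linearity

/-! ### Measurability, symmetry and bounds for the kernels -/

section Kernels

/-- The kernel `h1`, truncated at `1`; on positive arguments it agrees with `h1`. -/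
noncomputable def h1Trunc (d x y : ℝ) : ℝ := min (h1 d x y) 1

theorem measurable_h1 (d : ℝ) : Measurable (Function.uncurry (h1 d)) := by
  refine Measurable.ite (measurableSet_lt measurable_const
    (measurable_fst.add measurable_snd)) ?_ measurable_const
  exact (measurable_fst.sub measurable_snd).abs.div (measurable_fst.add measurable_snd)

theorem measurable_h1Trunc (d : ℝ) : Measurable (Function.uncurry (h1Trunc d)) :=
  (measurable_h1 d).min measurable_const

theorem measurable_h2 (d : ℝ) : Measurable (Function.uncurry (h2 d)) :=
  Measurable.ite (measurableSet_lt measurable_const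
    (measurable_fst.add measurable_snd)) measurable_const measurable_const

theorem h1_symm (d x y : ℝ) : h1 d x y = h1 d y x := by
  unfold h1
  rw [add_comm x y, abs_sub_comm x y]

theorem h2_symm (d x y : ℝ) : h2 d x y = h2 d y x := by
  unfold h2
  rw [add_comm x y]

theorem h1_nonneg {d : ℝ} (hd : 0 < d) (x y : ℝ) : 0 ≤ h1 d x y := by
  unfold h1
  split_ifs with h
  · exact div_nonneg (abs_nonneg _) (hd.trans h).le
  · exact le_rfl

theorem abs_h1Trunc_le {d : ℝ} (hd : 0 < d) (x y : ℝ) : |h1Trunc d x y| ≤ 1 := by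
  rw [h1Trunc, abs_of_nonneg (le_min (h1_nonneg hd x y) zero_le_one)]
  exact min_le_right _ _

theorem abs_h2_le (d x y : ℝ) : |h2 d x y| ≤ 1 := by
  unfold h2
  split_ifs <;> simp

theorem h1Trunc_eq {d x y : ℝ} (hx : 0 < x) (hy : 0 < y) : h1Trunc d x y = h1 d x y := by
  refine min_eq_left ?_
  unfold h1
  split_ifs with h
  · rw [div_le_one (by positivity), abs_le]
    constructor <;> linarith
  · exact zero_le_one

end Kernels

/-! ### Invariance under truncation; means of the kernels -/

section Truncation

variable {Ω : Type*} [MeasurableSpace Ω] {P : Measure Ω} {X : ℕ → Ω → ℝ}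

theorem theta_h1Trunc (hpos : ∀ i, ∀ᵐ ω ∂P, 0 < X i ω) (d : ℝ) :
    theta P X (h1Trunc d) = theta P X (h1 d) := by
  refine integral_congr_ae ?_
  filter_upwards [hpos 0, hpos 1] with ω h0 h1 using h1Trunc_eq h0 h1

theorem psi_h1Trunc (hpos : ∀ i, ∀ᵐ ω ∂P, 0 < X i ω) (d : ℝ) {x : ℝ} (hx : 0 < x) :
    psi P X (h1Trunc d) x = psi P X (h1 d) x := by
  unfold psi
  rw [theta_h1Trunc hpos]
  refine integral_congr_ae ?_
  filter_upwards [hpos 1] with ω h1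
  rw [h1Trunc_eq hx h1]

theorem eta_h1Trunc_self (hpos : ∀ i, ∀ᵐ ω ∂P, 0 < X i ω) (d : ℝ) :
    eta P X (h1Trunc d) (h1Trunc d) = eta P X (h1 d) (h1 d) := by
  refine integral_congr_ae ?_
  filter_upwards [hpos 0] with ω h0
  rw [psi_h1Trunc hpos d h0]

theorem eta_h1Trunc_left (hpos : ∀ i, ∀ᵐ ω ∂P, 0 < X i ω) (d : ℝ) (k : ℝ → ℝ → ℝ) :
    eta P X (h1Trunc d) k = eta P X (h1 d) k := by
  refine integral_congr_ae ?_
  filter_upwards [hpos 0] with ω h0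
  rw [psi_h1Trunc hpos d h0]

theorem uStat_h1Trunc (hpos : ∀ i, ∀ᵐ ω ∂P, 0 < X i ω) (d : ℝ) (n : ℕ) :
    uStat (h1Trunc d) X n =ᵐ[P] uStat (h1 d) X n := by
  filter_upwards [ae_all_iff.2 hpos] with ω h
  unfold uStat
  simp only [h1Trunc_eq (h _) (h _)]

theorem nullMeasurableSet_tail (hX : ∀ i, AEMeasurable (X i) P) (d : ℝ) :
    NullMeasurableSet {ω | d < X 0 ω + X 1 ω} P :=
  nullMeasurableSet_lt aemeasurable_const ((hX 0).add (hX 1))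

theorem theta_h2 (hX : ∀ i, AEMeasurable (X i) P) (d : ℝ) :
    theta P X (h2 d) = nu P X d := by
  have h : (fun ω => h2 d (X 0 ω) (X 1 ω))
      = {ω | d < X 0 ω + X 1 ω}.indicator fun _ => (1 : ℝ) := by
    ext ω
    simp [h2, Set.indicator_apply]
  rw [theta, h, integral_indicator₀ (nullMeasurableSet_tail hX d)]
  simp [nu]

/-- Conditioning is restriction to the tail event divided by `nu`. This identity is what centres the
kernel `κ` of the main proof. -/
theorem g_mul_nu (hX : ∀ i, AEMeasurable (X i) P) {d : ℝ} (hnu : 0 < nu P X d) :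
    g P X d * nu P X d = theta P X (h1 d) := by
  have h : (fun ω => h1 d (X 0 ω) (X 1 ω)) = {ω | d < X 0 ω + X 1 ω}.indicator
      fun ω => |X 0 ω - X 1 ω| / (X 0 ω + X 1 ω) := by
    ext ω
    simp [h1, Set.indicator_apply]
  rw [theta, h, integral_indicator₀ (nullMeasurableSet_tail hX d), g, ProbabilityTheory.cond,
    integral_smul_measure, ENNReal.toReal_inv, smul_eq_mul]
  change (nu P X d)⁻¹ * _ * nu P X d = _
  field_simp

end Truncation

/-! ### Slutsky's theorem for ratios -/

section Ratio

variable {Ω : Type*} [MeasurableSpace Ω] {P : Measure Ω} [IsProbabilityMeasure P]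

/-- Convergence in distribution depends on the limit variable only through its law. -/
theorem tendstoInDistribution_id_of_hasLaw {Ω' : Type*} [MeasurableSpace Ω'] {P' : Measure Ω'}
    [IsProbabilityMeasure P'] {Y : ℕ → Ω → ℝ} {Z : Ω' → ℝ} {μ : Measure ℝ}
    [IsProbabilityMeasure μ] (h : TendstoInDistribution Y atTop Z (fun _ => P) P')
    (hZ : HasLaw Z μ P') : TendstoInDistribution Y atTop id (fun _ => P) μ where
  forall_aemeasurable := h.forall_aemeasurable
  tendsto := by
    convert! h.tendsto using 3
    exact congrArg 𝓝 (Subtype.ext (Measure.map_id.trans hZ.map_eq.symm))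

/-- If `A_n` converges in distribution and `U_n` converges in probability to `u > 0`, then the
ratios `A_n / U_n` converge in distribution. -/
theorem tendstoInDistribution_div {Ω' : Type*} [MeasurableSpace Ω'] {P' : Measure Ω'}
    [IsProbabilityMeasure P'] {A U : ℕ → Ω → ℝ} {Z : Ω' → ℝ} {u : ℝ} (hu : 0 < u)
    (hA : TendstoInDistribution A atTop Z (fun _ => P) P')
    (hU : TendstoInMeasure P (fun n ω => U n ω - u) atTop 0)
    (hUm : ∀ n, AEMeasurable (U n) P) :
    TendstoInDistribution (fun n ω => A n ω / U n ω) atTop (fun ω => Z ω / u)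
      (fun _ => P) P' := by
  have hU' : TendstoInMeasure P U atTop fun _ => u := by
    rw [tendstoInMeasure_iff_norm] at hU ⊢
    simpa using hU
  -- Division is discontinuous at a zero denominator, so the denominator is cut off below at `u /
  -- 2`; this changes nothing unless `U_n` is at least `u / 2` away from `u`.
  have hcont : Continuous fun z : ℝ × ℝ => z.1 / max z.2 (u / 2) :=
    continuous_fst.div (continuous_snd.max continuous_const) fun z =>
      (lt_of_lt_of_le (half_pos hu) (le_max_right _ _)).ne'
  have hlim := hA.continuous_comp_prodMk_of_tendstoInMeasure_const hcont hU' hUm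
  simp only [max_eq_left (half_le_self hu.le)] at hlim
  refine tendstoInDistribution_of_tendstoInMeasure_sub _ _ hlim ?_ fun n =>
    (hA.forall_aemeasurable n).div (hUm n)
  have hU2 := tendstoInMeasure_iff_measureReal_norm.1 hU (u / 2) (half_pos hu)
  refine tendstoInMeasure_zero_of_eq_zero_off (fun n ω hω => ?_) hU2
  simp only [Set.mem_ofPred_eq, Pi.zero_apply, sub_zero, Real.norm_eq_abs, not_le] at hω
  have := (abs_lt.1 hω).1
  simp only [Pi.sub_apply]
  rw [max_eq_left (by linarith), sub_self]

end Ratio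

end GammaTail

/-! ### The limit theorem for the ratio estimator -/

theorem theorem4 {Ω : Type*} [MeasurableSpace Ω] (P : Measure Ω) [IsProbabilityMeasure P]
    (X : ℕ → Ω → ℝ)
    (hindep : iIndepFun X P)
    (hident : ∀ i, IdentDistrib (X i) (X 0) P P)
    (hpos : ∀ i, ∀ᵐ ω ∂P, 0 < X i ω)
    (hdens : HasPDF (X 0) P)
    (d : ℝ) (hd : 0 < d)
    (hnu : 0 < GammaTail.nu P X d)
    (heta1 : 0 < GammaTail.eta P X (GammaTail.h1 d) (GammaTail.h1 d))
    (heta2 : 0 < GammaTail.eta P X (GammaTail.h2 d) (GammaTail.h2 d)) :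
    0 ≤ GammaTail.sigmaSq P X d ∧
      TendstoInDistribution
        (fun (n : ℕ) (ω : Ω) =>
          √((n : ℝ) * GammaTail.nu P X d) * (GammaTail.gHat X d n ω - GammaTail.g P X d))
        atTop (id : ℝ → ℝ) (fun _ => P)
        (gaussianReal 0 (GammaTail.sigmaSq P X d).toNNReal) := by
  open GammaTail in
  have hX := aemeasurable_of_identDistrib hident
  set c := g P X d with hc
  set ν := nu P X d with hν
  set κ : ℝ → ℝ → ℝ := fun x y => h1Trunc d x y - c * h2 d x y with hκdef
  have hκ : Measurable (Function.uncurry κ) :=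
    (measurable_h1Trunc d).sub ((measurable_h2 d).const_mul c)
  have hκC : ∀ x y, |κ x y| ≤ 1 + |c| := fun x y => by
    refine (abs_sub _ _).trans <| add_le_add (abs_h1Trunc_le hd x y) ?_
    rw [abs_mul]
    exact mul_le_of_le_one_right (abs_nonneg _) (abs_h2_le d x y)
  have hκs : ∀ x y, κ x y = κ y x := fun x y => by
    simp only [hκdef, h1Trunc, h1_symm d x y, h2_symm d x y]
  have hκθ : theta P X κ = 0 := by
    rw [theta_sub_mul hX (measurable_h1Trunc d) (measurable_h2 d) (abs_h1Trunc_le hd)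
      (abs_h2_le d), theta_h1Trunc hpos, theta_h2 hX, ← g_mul_nu hX hnu, sub_self]
  have hκη : sigmaSq P X d = 4 / ν * eta P X κ κ := by
    rw [eta_sub_mul hident (measurable_h1Trunc d) (measurable_h2 d) (abs_h1Trunc_le hd)
      (abs_h2_le d), eta_h1Trunc_self hpos, eta_h1Trunc_left hpos, sigmaSq]
  have hη : 0 ≤ eta P X κ κ := integral_nonneg fun ω => mul_self_nonneg _
  have hσ : 0 ≤ sigmaSq P X d := hκη ▸ mul_nonneg (by positivity) hη
  refine ⟨hσ, ?_⟩
  have hclt := tendstoInDistribution_uStat hindep hident hκ hκC hκs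
  have hU := tendstoInMeasure_uStat hindep hident (measurable_h2 d) (abs_h2_le d) (h2_symm d)
  rw [theta_h2 hX] at hU
  have hratio := (tendstoInDistribution_div hnu hclt hU
    fun n => aemeasurable_uStat hX (measurable_h2 d) n).continuous_comp
      (g := fun x : ℝ => √ν * x) (by fun_prop)
  -- The limit is scaled by `√ν * 2 / ν`, whose square is the factor `4 / ν` in the variance.
  have hlaw : HasLaw ((fun x : ℝ => √ν * x) ∘ fun x : ℝ => 2 * x / ν)
      (gaussianReal 0 (sigmaSq P X d).toNNReal) (gaussianReal 0 (eta P X κ κ).toNNReal) := by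
    have h := gaussianReal_const_mul (HasLaw.id (μ := gaussianReal 0 (eta P X κ κ).toNNReal))
      (√ν * 2 / ν)
    convert! h using 1
    · ext x
      simp only [Function.comp_apply, id]
      ring
    · congr 1
      · simp
      · ext
        rw [Real.coe_toNNReal _ hσ, hκη]
        simp only [NNReal.coe_mul, NNReal.coe_mk, Real.coe_toNNReal _ hη, div_pow, mul_pow,
          Real.sq_sqrt hnu.le]
        field_simp
        ring
  refine tendstoInDistribution_of_tendstoInMeasure_sub _ _
    (tendstoInDistribution_id_of_hasLaw hratio hlaw) ?_ fun n =>
      (((aemeasurable_uStat hX (measurable_h1 d) n).div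
        (aemeasurable_uStat hX (measurable_h2 d) n)).sub_const _).const_mul _
  have hzero : TendstoInMeasure P (fun (n : ℕ) ω =>
      √((n : ℝ) * ν) * (uStat (h1Trunc d) X n ω / uStat (h2 d) X n ω - c)
        - √ν * (√(n : ℝ) * (uStat κ X n ω - theta P X κ) / uStat (h2 d) X n ω)) atTop 0 := by
    -- The two expressions agree when the denominator is nonzero; a zero denominator lies at
    -- distance exactly `ν` from its limit, hence in an event of vanishing probability. The value
    -- given to the ratio there is irrelevant.
    refine tendstoInMeasure_zero_of_eq_zero_off (fun n ω hω => ?_)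
      (tendstoInMeasure_iff_measureReal_norm.1 hU ν hnu)
    have hne : uStat (h2 d) X n ω ≠ 0 := by
      rintro h0
      refine hω ?_
      simp [h0, abs_of_pos hnu, ← hν]
    rw [hκθ, uStat_sub_mul, Real.sqrt_mul (Nat.cast_nonneg n)]
    field_simp
    ring
  refine hzero.congr (fun n => ?_) .rfl
  filter_upwards [uStat_h1Trunc hpos d n] with ω hω
  simp only [Pi.sub_apply, Function.comp_apply, gHat, hω]
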